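/- **Setting.** Let $S_p$ be a finite state space. A program $\delta_p$, an environment $\delta_e$, a set of faults $f$, a set of bad transitions $\delta_b$ and a set of program restrictions $\delta_r$ are subsets of $S_p\times S_p$. A *computation* of $\delta_p[]_k\delta_e$ is a sequence of states $s_0,s_1,\dots$ in which each step $(s_i,s_{i+1})$ is executed either by the program (and lies in $\delta_p$) or by the environment (and lies in $\delta_e$), such that in each of the $k-1$ steps following an environment step the program executes if some transition of $\delta_p$ starts in the current state; the sequence is infinite, or ends in a state where no transition of $\delta_p\cup\delta_e$ starts. Who executes a step is part of the computation. A computation of $\delta_p[]_k\delta_e[]f$ may in addition contain finitely many steps executed by faults (lying in $f$), which may occur at any time, also when the program has priority over the environment. A specification $spec$ consists of $\delta_b$ (safety: no step lies in $\delta_b$) and a leads-to property $L\leadsto T$ (liveness: every state in $L$ is in $T$ or is followed by a state in $T$). $\delta_p[]_k\delta_e$ *refines* $spec$ from $S$ if $S$ is closed in $\delta_p\cup\delta_e$ and every computation starting in $S$ satisfies safety and liveness. It is *failsafe $f$-tolerant* to $spec$ from $S$ if moreover every finite prefix of a computation of $\delta_p[]_k\delta_e[]f$ starting in $S$ satisfies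 safety. **Problem.** Given are $\delta_p,\delta_e,\delta_b,\delta_r,f$ and $S\subseteq S_p$ such that $\delta_p[]_2\delta_e$ refines $spec$ from $S$, $\delta_p\cap\delta_r=\emptyset$, and for every $s_0\in S$ there is $s_1\in S$ with $(s_0,s_1)\in\delta_p\cup\delta_e$. A *solution* is a pair $(\delta_p',S')$ with $S'\neq\emptyset$ such that (C1) every computation of $\delta_p'[]_2\delta_e$ starting in $S'$ is a computation of $\delta_p[]_2\delta_e$ starting in $S$; (C2) $\delta_p'[]_2\delta_e$ is failsafe $f$-tolerant to $spec$ from $S'$; (C3) $\delta_p'\cap\delta_r=\emptyset$. **Algorithm.** 1. Let $ms_1=\{s_0:\exists s_1,\ (s_0,s_1)\in f\cap\delta_b\}$ and $ms_2=ms_1\cup\{s_0:\exists s_1,\ (s_0,s_1)\in\delta_e\cap\delta_b\}$; throughout, $mt$ is recomputed from the current $ms_2$ as $\{(s_0,s_1):(s_0,s_1)\in\delta_b\cup\delta_r\text{ or }s_1\in ms_2\}$. Repeat until $ms_1,ms_2$ are unchanged: add to $ms_1$ every $s_0$ with a transition of $f$ into $ms_2$, and every $s_0$ that has a transition of $\delta_e$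 that is in $\delta_b$ or leads into $ms_1$ and for which $(s_0,s_2)\in mt$ for all $s_2$; then add to $ms_2$ the set $ms_1$ and every $s_0$ with a transition of $\delta_e$ into $ms_1$; then recompute $mt$. 2. Let $\delta'=(\delta_p\cap S\times S)\setminus mt$ and $S'=RD(S\setminus ms_2,\delta',\delta_e)$. Here $RD(X,\delta,\delta_e)$ repeats until $X$ is unchanged: remove from $X$ the states without a transition of $\delta\cup\delta_e$ into $X$, then the states from which a transition of $\delta_e$ leaves $X$. 3. Repeat until $S'$ is unchanged: if $S'=\emptyset$, declare failure; remove from $\delta'$ all transitions from $S'$ to its complement; let $ms_3$ be the set of states at which both a $\delta_e$- and a $\delta_p$-transition start but no $\delta'$-transition starts, and $ms_4$ the set of states with a $\delta_e$-transition into $ms_3$; replace $S'$ by $RD(S'\setminus ms_4,\delta_p,\delta_e)$. 4. Return $\delta_p'=(\delta'\cup(S_p\setminus S')\times S_p)\setminus mt$ and $S'$. **Theorem 2.** There is a polynomial $P$ such that, for every state space with $n$ elements and every input, the algorithm terminates after at most $P(n)$ elementary steps (reading or writing an entry of a Boolean table that stores a set of states or of transitions, a Boolean operation, or a pass through a loop).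 For every input as in the problem it is sound and complete: if it returns $(\delta_p',S')$, then $S'\subseteq S$ and $(\delta_p',S')$ is a solution; if it declares failure, then no solution exists. -/

import Mathlib

namespace FailsafeTolerance

/-! ## Programs, environments and their computations

The state space is a type `σ`; programs, environments, faults and sets of bad or restricted
transitions are sets of pairs of states. -/

/-- A set of transitions over the state space `σ`. -/
abbrev Trans (σ : Type) : Type := Set (σ × σ)

/-- Who executes a step. -/
inductive Actor where
  | program
  | environment
  | fault

/-- A finite or infinite sequence of steps: `steps` is the number of steps (`⊤` if infinite), the
states are `state i` for `i ≤ steps`, and step `i`, for `i < steps`, leads from `state i` to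
`state (i + 1)` and is executed by `actor i`.  Values beyond `steps` are irrelevant to all the
notions below. -/
structure Run (σ : Type) where
  steps : ℕ∞
  state : ℕ → σ
  actor : ℕ → Actor

/-- The transition made in step `i`. -/
def Run.edge {σ : Type} (r : Run σ) (i : ℕ) : σ × σ := (r.state i, r.state (i + 1))

/-- The prefix consisting of the first `m` steps. -/
def Run.take {σ : Type} (r : Run σ) (m : ℕ) : Run σ := { r with steps := m }

/-- `δ` has a transition that starts in `s`. -/
def Enabled {σ : Type} (δ : Trans σ) (s : σ) : Prop := ∃ s', (s, s') ∈ δ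

/-- `r` is a computation of the program `δp` in the environment `δe` with fairness parameter `k`:
every step is a program or an environment transition; in the `k - 1` steps after an
environment step, the program executes whenever it can; and the sequence ends only in a deadlock
of `δp ∪ δe`. -/
structure IsComputation {σ : Type} (k : ℕ) (δp δe : Trans σ) (r : Run σ) : Prop where
  step : ∀ i : ℕ, (i : ℕ∞) < r.steps →
    (r.actor i = Actor.program ∧ r.edge i ∈ δp) ∨
    (r.actor i = Actor.environment ∧ r.edge i ∈ δe)
  fair : ∀ i : ℕ, (i : ℕ∞) < r.steps → r.actor i = Actor.environment →
    ∀ l : ℕ, i < l → l < i + k → (l : ℕ∞) < r.steps →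
      Enabled δp (r.state l) → r.actor l = Actor.program
  maximal : ∀ n : ℕ, r.steps = n → ¬ Enabled (δp ∪ δe) (r.state n)

/-- `r` is a computation of the program `δp` in the environment `δe` in the presence of the
faults `f`: in addition there may be finitely many fault steps, which can occur at any time. -/
structure IsFaultComputation {σ : Type} (k : ℕ) (δp δe f : Trans σ) (r : Run σ) : Prop where
  step : ∀ i : ℕ, (i : ℕ∞) < r.steps →
    (r.actor i = Actor.program ∧ r.edge i ∈ δp) ∨
    (r.actor i = Actor.environment ∧ r.edge i ∈ δe) ∨
    (r.actor i = Actor.fault ∧ r.edge i ∈ f)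
  fair : ∀ i : ℕ, (i : ℕ∞) < r.steps → r.actor i = Actor.environment →
    ∀ l : ℕ, i < l → l < i + k → (l : ℕ∞) < r.steps →
      Enabled δp (r.state l) → r.actor l = Actor.program ∨ r.actor l = Actor.fault
  finite_faults : ∃ n : ℕ, ∀ j : ℕ, n ≤ j → (j : ℕ∞) < r.steps → r.actor j ≠ Actor.fault
  maximal : ∀ n : ℕ, r.steps = n → ¬ Enabled (δp ∪ δe) (r.state n)

/-- The state predicate `S` is closed in `δ`. -/
def IsClosedIn {σ : Type} (S : Set σ) (δ : Trans σ) : Prop :=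
  ∀ s₀ s₁ : σ, (s₀, s₁) ∈ δ → s₀ ∈ S → s₁ ∈ S

/-! ## Specifications and failsafe fault-tolerance -/

/-- A specification: the set `bad` of transitions that must not be executed (safety) and
a leads-to property from `L` to `T` (liveness). -/
structure Spec (σ : Type) where
  bad : Trans σ
  L : Set σ
  T : Set σ

/-- No step of `r` is a transition in `δb`. -/
def RefinesSafety {σ : Type} (δb : Trans σ) (r : Run σ) : Prop :=
  ∀ j : ℕ, (j : ℕ∞) < r.steps → r.edge j ∉ δb

/-- Whenever `L` holds in a state of `r`, `T` holds in that state or in a later one. -/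
def RefinesLiveness {σ : Type} (L T : Set σ) (r : Run σ) : Prop :=
  ∀ j : ℕ, (j : ℕ∞) ≤ r.steps → r.state j ∈ L →
    ∃ i : ℕ, j ≤ i ∧ (i : ℕ∞) ≤ r.steps ∧ r.state i ∈ T

/-- The program `δp` in the environment `δe` refines `spec` from `S`. -/
def Refines {σ : Type} (k : ℕ) (δp δe : Trans σ) (spec : Spec σ) (S : Set σ) : Prop :=
  IsClosedIn S (δp ∪ δe) ∧
  ∀ r : Run σ, IsComputation k δp δe r → r.state 0 ∈ S →
    RefinesSafety spec.bad r ∧ RefinesLiveness spec.L spec.T r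

/-- The program `δp` in the environment `δe` is failsafe `f`-tolerant to `spec` from `S`. -/
def IsFailsafe {σ : Type} (k : ℕ) (δp δe f : Trans σ) (spec : Spec σ) (S : Set σ) : Prop :=
  Refines k δp δe spec S ∧
  ∀ r : Run σ, IsFaultComputation k δp δe f r → r.state 0 ∈ S →
    ∀ m : ℕ, (m : ℕ∞) ≤ r.steps → RefinesSafety spec.bad (r.take m)

/-- The program `δp'` with the invariant `S'` solves the problem of adding failsafe
`f`-tolerance to the program `δp` with the invariant `S`. -/
structure IsFailsafeAddition {σ : Type} (k : ℕ) (δp δe f δr : Trans σ) (spec : Spec σ)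
    (S : Set σ) (δp' : Trans σ) (S' : Set σ) : Prop where
  nonempty : S'.Nonempty
  c1 : ∀ r : Run σ, IsComputation k δp' δe r → r.state 0 ∈ S' →
    IsComputation k δp δe r ∧ r.state 0 ∈ S
  c2 : IsFailsafe k δp' δe f spec S'
  c3 : δp' ∩ δr = ∅

/-! ## A step-counting model

Sets of states and sets of transitions are stored as Boolean tables.  Each of the following costs
one step: reading or writing an entry of a table, a Boolean operation, and each pass through
a loop.  Loops need not terminate. -/

/-- Computations that carry a step counter and may fail to terminate (`none`). -/
abbrev Timed (α : Type) : Type := StateT ℕ Option α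

/-- Spend one step. -/
def tick : Timed Unit := fun n => some ((), n + 1)

/-- Reading one entry of a table. -/
def readAt {α : Type} (t : α → Bool) (x : α) : Timed Bool := do
  tick
  pure (t x)

/-- Conjunction; both arguments are evaluated. -/
def andT (a b : Timed Bool) : Timed Bool := do
  let x ← a
  let y ← b
  tick
  pure (x && y)

/-- Disjunction; both arguments are evaluated. -/
def orT (a b : Timed Bool) : Timed Bool := do
  let x ← a
  let y ← b
  tick
  pure (x || y)

/-- Negation. -/
def notT (a : Timed Bool) : Timed Bool := do
  let x ← a
  tick
  pure (!x)

infixr:35 " ∧ₜ " => andT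
infixr:30 " ∨ₜ " => orT
prefix:40 "¬ₜ " => notT

/-- A loop over all states, testing whether `c` holds for one of them. -/
def existsT {σ : Type} [FinEnum σ] (c : σ → Timed Bool) : Timed Bool :=
  (FinEnum.toList σ).foldlM (fun acc x => do
    let b ← c x
    tick
    pure (acc || b)) false

/-- A loop over all states, testing whether `c` holds for all of them. -/
def forallT {σ : Type} [FinEnum σ] (c : σ → Timed Bool) : Timed Bool :=
  (FinEnum.toList σ).foldlM (fun acc x => do
    let b ← c x
    tick
    pure (acc && b)) true

/-- A loop over all states that writes the table of `{x | c x}`. -/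
def setT {σ : Type} [FinEnum σ] (c : σ → Timed Bool) : Timed (σ → Bool) :=
  (FinEnum.toList σ).foldlM (fun t x => do
    let b ← c x
    tick
    pure (Function.update t x b)) (fun _ => false)

/-- A double loop over all states that writes the table of `{(x, y) | c x y}`. -/
def relT {σ : Type} [FinEnum σ] (c : σ → σ → Timed Bool) : Timed (σ × σ → Bool) :=
  (FinEnum.toList σ).foldlM (fun t x =>
    (FinEnum.toList σ).foldlM (fun t y => do
      let b ← c x y
      tick
      pure (Function.update t (x, y) b)) t) (fun _ => false)

/-- Comparison of two tables, entry by entry. -/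
def eqT {σ : Type} [FinEnum σ] (A B : σ → Bool) : Timed Bool :=
  forallT fun x => do
    let a ← readAt A x
    let b ← readAt B x
    tick
    pure (a == b)

/-- At most `m` passes through a loop whose body returns `Sum.inl` to go on and `Sum.inr` to exit;
`none` if the loop has not ended by then. -/
def loopUpTo {α β : Type} (body : α → Timed (α ⊕ β)) : ℕ → α → Timed β
  | 0, _ => failure
  | m + 1, a => do
    tick
    let r ← body a
    match r with
    | Sum.inl a' => loopUpTo body m a'
    | Sum.inr b => pure b

open Classical in
/-- Unbounded repetition: the body is executed until it returns `Sum.inr`; `none` if this never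
happens. -/
noncomputable def loopT {α β : Type} (body : α → Timed (α ⊕ β)) (a : α) : Timed β := fun n =>
  if h : ∃ m, (loopUpTo body m a n).isSome then loopUpTo body (Nat.find h) a n else none

/-! ## The algorithm -/

/-- The input: the program `δp` with its invariant `S`, the environment `δe`, the bad
transitions `δb`, the program restrictions `δr` and the faults `f`, all stored as tables. -/
structure Input (σ : Type) where
  δp : σ × σ → Bool
  δe : σ × σ → Bool
  S : σ → Bool
  δb : σ × σ → Bool
  δr : σ × σ → Bool
  f : σ × σ → Bool

/-- The set stored in a table. -/
def toSet {α : Type} (t : α → Bool) : Set α := {x | t x = true}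

/-- Repeatedly removes from `S` the states without a transition of `δp ∪ δe` into `S` and then
the states from which `δe` leaves `S`, until `S` does not change. -/
noncomputable def removeDeadlock {σ : Type} [FinEnum σ] (S : σ → Bool) (δp δe : σ × σ → Bool) :
    Timed (σ → Bool) :=
  loopT (fun S => do
    let S₁ ← setT fun s₀ => readAt S s₀ ∧ₜ
      existsT fun s₁ => readAt S s₁ ∧ₜ (readAt δp (s₀, s₁) ∨ₜ readAt δe (s₀, s₁))
    let S₂ ← setT fun s₀ => readAt S₁ s₀ ∧ₜ
      ¬ₜ existsT fun s₁ => readAt δe (s₀, s₁) ∧ₜ ¬ₜ readAt S₁ s₁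
    let unchanged ← eqT S S₂
    pure (if unchanged then Sum.inr S₂ else Sum.inl S₂)) S

/-- Removes from `δ` the transitions that leave `S`. -/
def ensureClosure {σ : Type} [FinEnum σ] (δ : σ × σ → Bool) (S : σ → Bool) :
    Timed (σ × σ → Bool) :=
  relT fun s₀ s₁ => readAt δ (s₀, s₁) ∧ₜ ¬ₜ (readAt S s₀ ∧ₜ ¬ₜ readAt S s₁)

/-- `mt = {(s₀, s₁) | (s₀, s₁) ∈ δb ∪ δr ∨ s₁ ∈ ms₂}`. -/
def computeMt {σ : Type} [FinEnum σ] (I : Input σ) (ms₂ : σ → Bool) : Timed (σ × σ → Bool) :=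
  relT fun s₀ s₁ => readAt I.δb (s₀, s₁) ∨ₜ readAt I.δr (s₀, s₁) ∨ₜ readAt ms₂ s₁

/-- The first phase: the final values of `ms₂` and `mt`. -/
noncomputable def computeMs {σ : Type} [FinEnum σ] (I : Input σ) : Timed ((σ → Bool) × (σ × σ → Bool)) := do
  let ms₁ ← setT fun s₀ => existsT fun s₁ => readAt I.f (s₀, s₁) ∧ₜ readAt I.δb (s₀, s₁)
  let ms₂ ← setT fun s₀ => readAt ms₁ s₀ ∨ₜ
    existsT fun s₁ => readAt I.δe (s₀, s₁) ∧ₜ readAt I.δb (s₀, s₁)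
  let mt ← computeMt I ms₂
  loopT (fun v => do
    let ms₁ := v.1
    let ms₂ := v.2.1
    let mt := v.2.2
    let ms₁' ← setT fun s₀ => readAt ms₁ s₀
      ∨ₜ (existsT fun s₁ => readAt ms₂ s₁ ∧ₜ readAt I.f (s₀, s₁))
      ∨ₜ ((existsT fun s₁ => (readAt ms₁ s₁ ∧ₜ readAt I.δe (s₀, s₁))
            ∨ₜ (readAt I.δe (s₀, s₁) ∧ₜ readAt I.δb (s₀, s₁)))
          ∧ₜ forallT fun s₂ => readAt mt (s₀, s₂))
    let ms₂' ← setT fun s₀ => readAt ms₂ s₀ ∨ₜ readAt ms₁' s₀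
      ∨ₜ existsT fun s₁ => readAt ms₁' s₁ ∧ₜ readAt I.δe (s₀, s₁)
    let mt' ← computeMt I ms₂'
    let unchanged ← eqT ms₁ ms₁' ∧ₜ eqT ms₂ ms₂'
    pure (if unchanged then Sum.inr (ms₂', mt') else Sum.inl (ms₁', ms₂', mt'))) (ms₁, ms₂, mt)

/-- The algorithm that adds failsafe fault-tolerance.  It returns the new program and the
new invariant, or `none` if it declares that there is no solution. -/
noncomputable def addFailsafe {σ : Type} [FinEnum σ] (I : Input σ) :
    Timed (Option ((σ × σ → Bool) × (σ → Bool))) := do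
  let v ← computeMs I
  let ms₂ := v.1
  let mt := v.2
  let δ₀ ← relT fun s₀ s₁ =>
    (readAt I.δp (s₀, s₁) ∧ₜ readAt I.S s₀ ∧ₜ readAt I.S s₁) ∧ₜ ¬ₜ readAt mt (s₀, s₁)
  let A ← setT fun s => readAt I.S s ∧ₜ ¬ₜ readAt ms₂ s
  let S₀ ← removeDeadlock A δ₀ I.δe
  let res ← loopT (fun w => do
    let δ := w.1
    let S := w.2
    let nonempty ← existsT fun s => readAt S s
    if nonempty then do
      let δ' ← ensureClosure δ S
      let ms₃ ← setT fun s₀ =>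
        ((existsT fun s₁ => readAt I.δe (s₀, s₁)) ∧ₜ (existsT fun s₂ => readAt I.δp (s₀, s₂)))
        ∧ₜ ¬ₜ existsT fun s₃ => readAt δ' (s₀, s₃)
      let ms₄ ← setT fun s₀ => existsT fun s₁ => readAt ms₃ s₁ ∧ₜ readAt I.δe (s₀, s₁)
      let B ← setT fun s => readAt S s ∧ₜ ¬ₜ readAt ms₄ s
      let S' ← removeDeadlock B I.δp I.δe
      let unchanged ← eqT S S'
      pure (if unchanged then Sum.inr (some (δ', S')) else Sum.inl (δ', S'))
    else pure (Sum.inr none)) (δ₀, S₀)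
  match res with
  | none => pure none
  | some (δ, S') => do
    let δ' ← relT fun s₀ s₁ =>
      (readAt δ (s₀, s₁) ∨ₜ ¬ₜ readAt S' s₀) ∧ₜ ¬ₜ readAt mt (s₀, s₁)
    pure (some (δ', S'))

end FailsafeTolerance

/-! For fairness parameter 2, the only history that matters is whether the environment has just
executed. Safety is therefore governed by two sets: `M₁`, from which faults and environment can
force a violation even when the program has priority, and `M₂ ⊇ M₁`, from which they can do so when
it has none. The first phase computes the least pair closed under the rules of `IsUnsafePair`.

For soundness any such pair suffices (`IsFaultComputation.refinesSafety`). A program that avoids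
`M₂`, but keeps every harmless transition from states of `M₂`, is found in `M₂` only right after an
environment step, and never in `M₁`. For completeness minimality is used: for a program without
restricted transitions, the states from which some computation violates safety form an unsafe pair
(`isUnsafePair_violates`), so every solution has an invariant disjoint from `M₂`.

Without faults, C1 means that the new program creates neither a deadlock nor an opportunity for the
environment that the old program denied. `IsAdmissible` expresses this for a set `X`. An admissible
`X` yields a solution (`IsAdmissible.isFailsafeAddition`), because all old program transitions
inside `X` survive; conversely, the invariant of every solution is admissible, as is seen by testing
C1 on computations with one or two prescribed first steps (`IsFailsafeAddition.isAdmissible`). The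
loops discard only states that lie in no candidate invariant, so failure means that no candidate
exists.

Correctness and cost are proved together by a Hoare-style predicate `Returns`. Every unbounded loop
shrinks or enlarges sets of states monotonically, which bounds its number of passes linearly. -/

namespace FailsafeTolerance

/-! ## Total correctness with a bound on the number of steps -/

/-- `m` terminates after at most `c` steps with a result that satisfies `Q`. -/
def Returns {α : Type} (m : Timed α) (c : ℕ) (Q : α → Prop) : Prop :=
  ∀ n, ∃ a t, t ≤ c ∧ m n = some (a, n + t) ∧ Q a

theorem Returns.pure {α : Type} {a : α} {Q : α → Prop} (h : Q a) :
    Returns (Pure.pure a) 0 Q :=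
  fun _ => ⟨a, 0, le_rfl, rfl, h⟩

theorem Returns.bind {α β : Type} {m : Timed α} {k : α → Timed β} {c d : ℕ} {Q : α → Prop}
    {R : β → Prop} (hm : Returns m c Q) (hk : ∀ a, Q a → Returns (k a) d R) :
    Returns (m >>= k) (c + d) R := by
  intro n
  obtain ⟨a, t, ht, hma, ha⟩ := hm n
  obtain ⟨b, u, hu, hkb, hb⟩ := hk a ha (n + t)
  refine ⟨b, t + u, by omega, ?_, hb⟩
  change (m n).bind (fun p => k p.1 p.2) = _
  rw [hma, ← add_assoc]
  exact hkb

theorem Returns.mono {α : Type} {m : Timed α} {c d : ℕ} {Q R : α → Prop} (hm : Returns m c Q)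
    (hcd : c ≤ d) (hQR : ∀ a, Q a → R a) : Returns m d R := by
  intro n
  obtain ⟨a, t, ht, hma, ha⟩ := hm n
  exact ⟨a, t, ht.trans hcd, hma, hQR a ha⟩

theorem returns_tick : Returns tick 1 fun _ => True :=
  fun _ => ⟨(), 1, le_rfl, rfl, trivial⟩

/-- `m` decides `P` in at most `c` steps. -/
def Decides (m : Timed Bool) (c : ℕ) (P : Prop) : Prop :=
  Returns m c fun b => b = true ↔ P

theorem decides_readAt {α : Type} (t : α → Bool) (x : α) :
    Decides (readAt t x) 1 (t x = true) :=
  Returns.bind (d := 0) returns_tick fun _ _ => Returns.pure Iff.rfl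

theorem Decides.and {a b : Timed Bool} {c d : ℕ} {P Q : Prop} (ha : Decides a c P)
    (hb : Decides b d Q) : Decides (a ∧ₜ b) (c + (d + (1 + 0))) (P ∧ Q) :=
  Returns.bind ha fun x hx => Returns.bind hb fun y hy => Returns.bind returns_tick fun _ _ =>
    Returns.pure (by rw [Bool.and_eq_true, hx, hy])

theorem Decides.or {a b : Timed Bool} {c d : ℕ} {P Q : Prop} (ha : Decides a c P)
    (hb : Decides b d Q) : Decides (a ∨ₜ b) (c + (d + (1 + 0))) (P ∨ Q) :=
  Returns.bind ha fun x hx => Returns.bind hb fun y hy => Returns.bind returns_tick fun _ _ =>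
    Returns.pure (by rw [Bool.or_eq_true, hx, hy])

theorem Decides.not {a : Timed Bool} {c : ℕ} {P : Prop} (ha : Decides a c P) :
    Decides (¬ₜ a) (c + (1 + 0)) (¬ P) :=
  Returns.bind ha fun x hx => Returns.bind returns_tick fun _ _ =>
    Returns.pure (by rw [← hx]; simp)

/-- A loop over a list whose body preserves an invariant indexed by the elements still to be
processed. -/
theorem returns_foldlM {α β : Type} {f : β → α → Timed β} {c : ℕ} (Inv : List α → β → Prop)
    (hf : ∀ x l b, Inv (x :: l) b → Returns (f b x) c (Inv l)) :
    ∀ (l : List α) (b : β), Inv l b → Returns (l.foldlM f b) (l.length * c) (Inv [])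
  | [], b, h => by
    rw [List.foldlM_nil]
    exact (Returns.pure h).mono (by simp) fun _ h => h
  | x :: l, b, h => by
    rw [List.foldlM_cons]
    refine ((hf x l b h).bind fun b' hb' => returns_foldlM Inv hf l b' hb').mono ?_ fun _ h => h
    rw [List.length_cons]
    exact le_of_eq (by ring)

/-! ### Bounded loops over the state space -/

section Loops

variable {σ : Type} [FinEnum σ]

theorem length_toList : (FinEnum.toList σ).length = FinEnum.card σ := by
  simp [FinEnum.toList]

/-- Throughout the fold, the full quantifier stays equivalent to "the accumulator is true or the
unprocessed part of the list contains a witness". -/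
theorem decides_existsT {c : σ → Timed Bool} {k : ℕ} {P : σ → Prop}
    (h : ∀ x, Decides (c x) k (P x)) :
    Decides (existsT c) (FinEnum.card σ * (k + (1 + 0))) (∃ x, P x) := by
  have := returns_foldlM (f := fun acc x => do
      let b ← c x
      tick
      pure (acc || b)) (c := k + (1 + 0))
    (fun l b => (b = true ∨ ∃ x ∈ l, P x) ↔ ∃ x, P x)
    (fun x l b hb => (h x).bind fun b' hb' => returns_tick.bind fun _ _ => Returns.pure (by
      rw [← hb, Bool.or_eq_true, hb']; simp [or_assoc]))
    (FinEnum.toList σ) false (by simp)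
  rw [length_toList] at this
  exact this.mono le_rfl fun b hb => by simpa using hb

theorem decides_forallT {c : σ → Timed Bool} {k : ℕ} {P : σ → Prop}
    (h : ∀ x, Decides (c x) k (P x)) :
    Decides (forallT c) (FinEnum.card σ * (k + (1 + 0))) (∀ x, P x) := by
  have := returns_foldlM (f := fun acc x => do
      let b ← c x
      tick
      pure (acc && b)) (c := k + (1 + 0))
    (fun l b => (b = true ∧ ∀ x ∈ l, P x) ↔ ∀ x, P x)
    (fun x l b hb => (h x).bind fun b' hb' => returns_tick.bind fun _ _ => Returns.pure (by
      rw [← hb, Bool.and_eq_true, hb']; simp [and_assoc]))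
    (FinEnum.toList σ) true (by simp)
  rw [length_toList] at this
  exact this.mono le_rfl fun b hb => by simpa using hb

/-- The invariant is that every entry outside the unprocessed part of the list is correct. It is
vacuous at the start and covers the whole table at the end. -/
theorem returns_setT {c : σ → Timed Bool} {k : ℕ} {P : σ → Prop}
    (h : ∀ x, Decides (c x) k (P x)) :
    Returns (setT c) (FinEnum.card σ * (k + (1 + 0))) fun t => ∀ x, t x = true ↔ P x := by
  have := returns_foldlM (f := fun (t : σ → Bool) x => do
      let b ← c x
      tick
      pure (Function.update t x b)) (c := k + (1 + 0))
    (fun l t => ∀ x, x ∉ l → (t x = true ↔ P x))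
    (fun x l t ht => (h x).bind fun b hb => returns_tick.bind fun _ _ => Returns.pure (by
      intro y hy
      by_cases hyx : y = x
      · subst hyx
        simpa using hb
      · simpa [hyx] using ht y (by simp [hyx, hy])))
    (FinEnum.toList σ) (fun _ => false) (by simp)
  rw [length_toList] at this
  exact this.mono le_rfl fun t ht x => ht x (by simp)

theorem returns_relT {c : σ → σ → Timed Bool} {k : ℕ} {P : σ → σ → Prop}
    (h : ∀ x y, Decides (c x y) k (P x y)) :
    Returns (relT c) (FinEnum.card σ * (FinEnum.card σ * (k + (1 + 0))))
      fun t => ∀ x y, t (x, y) = true ↔ P x y := by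
  have inner : ∀ x (l : List σ) (t : σ × σ → Bool),
      (∀ z, z ∉ x :: l → ∀ y, t (z, y) = true ↔ P z y) →
      Returns ((FinEnum.toList σ).foldlM (fun t y => do
        let b ← c x y
        tick
        pure (Function.update t (x, y) b)) t) (FinEnum.card σ * (k + (1 + 0)))
        fun t => ∀ z, z ∉ l → ∀ y, t (z, y) = true ↔ P z y := by
    intro x l t ht
    have := returns_foldlM (f := fun (t : σ × σ → Bool) y => do
        let b ← c x y
        tick
        pure (Function.update t (x, y) b)) (c := k + (1 + 0))
      (fun l' t => (∀ z, z ∉ x :: l → ∀ y, t (z, y) = true ↔ P z y) ∧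
        ∀ y, y ∉ l' → (t (x, y) = true ↔ P x y))
      (fun y l' t ht => (h x y).bind fun b hb => returns_tick.bind fun _ _ => Returns.pure (by
        refine ⟨fun z hz y' => ?_, fun y' hy' => ?_⟩
        · have hzx : z ≠ x := fun e => hz (by simp [e])
          simpa [hzx] using ht.1 z hz y'
        · by_cases hyy : y' = y
          · subst hyy
            simpa using hb
          · simpa [hyy] using ht.2 y' (by simp [hyy, hy'])))
      (FinEnum.toList σ) t ⟨ht, by simp⟩
    rw [length_toList] at this
    refine this.mono le_rfl fun t ht z hz y => ?_
    by_cases hzx : z = x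
    · subst hzx
      exact ht.2 y (by simp)
    · exact ht.1 z (by simp [hzx, hz]) y
  have := returns_foldlM (f := fun (t : σ × σ → Bool) x =>
      (FinEnum.toList σ).foldlM (fun t y => do
        let b ← c x y
        tick
        pure (Function.update t (x, y) b)) t) (c := FinEnum.card σ * (k + (1 + 0)))
    (fun l t => ∀ z, z ∉ l → ∀ y, t (z, y) = true ↔ P z y)
    (fun x l t ht => inner x l t ht)
    (FinEnum.toList σ) (fun _ => false) (by simp)
  rw [length_toList] at this
  exact this.mono le_rfl fun t ht x => ht x (by simp)

theorem decides_eqT (A B : σ → Bool) :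
    Decides (eqT A B) (FinEnum.card σ * (3 + (1 + 0))) (A = B) := by
  refine (decides_forallT (P := fun x => A x = B x) fun x =>
    (Returns.bind (c := 1) (d := 2) (Q := fun a => a = A x) ?_ ?_)).mono le_rfl
      fun b hb => by rw [hb, funext_iff]
  · exact Returns.bind (d := 0) returns_tick fun _ _ => Returns.pure rfl
  · rintro _ rfl
    refine Returns.bind (c := 1) (d := 1) (Q := fun b => b = B x) ?_ ?_
    · exact Returns.bind (d := 0) returns_tick fun _ _ => Returns.pure rfl
    · rintro _ rfl
      exact Returns.bind (d := 0) returns_tick fun _ _ => Returns.pure (by simp)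

end Loops

/-! ### Unbounded loops -/

theorem loopUpTo_succ_eq {α β : Type} (body : α → Timed (α ⊕ β)) (m : ℕ) (a : α) (n : ℕ)
    {r : α ⊕ β} {n' : ℕ} (h : body a (n + 1) = some (r, n')) :
    loopUpTo body (m + 1) a n =
      Sum.elim (fun a' => loopUpTo body m a' n') (fun b => some (b, n')) r := by
  change (body a (n + 1)).bind _ = _
  rw [h]
  cases r <;> rfl

theorem loopUpTo_mono {α β : Type} (body : α → Timed (α ⊕ β)) :
    ∀ (m : ℕ) (a : α) (n : ℕ) (v : β × ℕ), loopUpTo body m a n = some v →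
      ∀ m', m ≤ m' → loopUpTo body m' a n = some v
  | 0, _, _, _, h, _, _ => nomatch h
  | m + 1, a, n, v, h, 0, hm => by omega
  | m + 1, a, n, v, h, m' + 1, hm => by
    rcases hb : body a (n + 1) with _ | ⟨r, n'⟩
    · change (body a (n + 1)).bind _ = _ at h
      rw [hb] at h
      exact nomatch h
    · rw [loopUpTo_succ_eq body m a n hb] at h
      rw [loopUpTo_succ_eq body m' a n hb]
      cases r with
      | inl a' => exact loopUpTo_mono body m a' n' v h m' (by omega)
      | inr b => exact h

/-- Extra fuel never changes a result, so the least sufficient fuel, which `loopT` selects, gives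
the same value as any other sufficient fuel. -/
theorem loopT_eq {α β : Type} (body : α → Timed (α ⊕ β)) {m : ℕ} {a : α} {n : ℕ} {v : β × ℕ}
    (h : loopUpTo body m a n = some v) : loopT body a n = some v := by
  classical
  have hex : ∃ m, (loopUpTo body m a n).isSome := ⟨m, by simp [h]⟩
  rw [loopT, dif_pos hex]
  obtain ⟨w, hw⟩ := Option.isSome_iff_exists.1 (Nat.find_spec hex)
  have := loopUpTo_mono body _ a n w hw m (Nat.find_min' hex (by simp [h]))
  rw [h] at this
  convert hw using 1

/-- A loop whose body preserves the invariant `Inv` and decreases `μ` until it exits. -/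
theorem returns_loopT {α β : Type} {body : α → Timed (α ⊕ β)} {c : ℕ} (Inv : α → Prop)
    (μ : α → ℕ) {Q : β → Prop}
    (hbody : ∀ a, Inv a → Returns (body a) c fun r =>
      match r with
      | Sum.inl a' => Inv a' ∧ μ a' < μ a
      | Sum.inr b => Q b)
    {a : α} (ha : Inv a) {N : ℕ} (hN : μ a ≤ N) :
    Returns (loopT body a) ((N + 1) * (c + 1)) Q := by
  -- Fuel `N + 1` is enough: at most `N` passes can decrease `μ`, and one more exits. Each pass
  -- costs its body plus one tick.
  have key : ∀ (N : ℕ) (a : α), Inv a → μ a ≤ N → ∀ n, ∃ b t, t ≤ (N + 1) * (c + 1) ∧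
      loopUpTo body (N + 1) a n = some (b, n + t) ∧ Q b := by
    intro N
    induction N with
    | zero =>
      intro a ha hN n
      obtain ⟨r, t, ht, hr, h⟩ := hbody a ha (n + 1)
      rw [loopUpTo_succ_eq body _ a n hr]
      cases r with
      | inl a' => exact absurd h.2 (by omega)
      | inr b => exact ⟨b, 1 + t, by omega, by simp [add_assoc], h⟩
    | succ N ih =>
      intro a ha hN n
      obtain ⟨r, t, ht, hr, h⟩ := hbody a ha (n + 1)
      rw [loopUpTo_succ_eq body _ a n hr]
      have hc : (N + 1 + 1) * (c + 1) = (N + 1) * (c + 1) + (c + 1) := by ring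
      cases r with
      | inl a' =>
        obtain ⟨b, u, hu, hb, hQ⟩ := ih a' h.1 (by have := h.2; omega) (n + 1 + t)
        exact ⟨b, 1 + t + u, by omega, hb.trans (by simp only [add_assoc]), hQ⟩
      | inr b => exact ⟨b, 1 + t, by omega, by simp [add_assoc], h⟩
  intro n
  obtain ⟨b, t, ht, hb, hQ⟩ := key N a ha hN n
  exact ⟨b, t, ht, loopT_eq body hb, hQ⟩

end FailsafeTolerance

namespace FailsafeTolerance

/-! ## What the algorithm computes -/

/-- The invariants in which no computation of `δp` in the environment `δe` deadlocks and which
`δe` does not leave. -/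
structure IsLive {σ : Type} (δp δe : Trans σ) (X : Set σ) : Prop where
  closed : IsClosedIn X δe
  live : ∀ s ∈ X, ∃ t ∈ X, (s, t) ∈ δp ∪ δe

theorem IsLive.mono {σ : Type} {δ δ' δe : Trans σ} {X : Set σ} (hX : IsLive δ δe X) (h : δ ⊆ δ') :
    IsLive δ' δe X where
  closed := hX.closed
  live s hs := by
    obtain ⟨t, ht, hst⟩ := hX.live s hs
    exact ⟨t, ht, hst.imp_left fun h' => h h'⟩

theorem Returns.ite {α : Type} {b : Bool} {m m' : Timed α} {c d : ℕ} {Q : α → Prop}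
    (h : b = true → Returns m c Q) (h' : ¬ b = true → Returns m' d Q) :
    Returns (if b then m else m') (c + d) Q := by
  split_ifs with hb
  · exact (h hb).mono (by omega) fun _ h => h
  · exact (h' hb).mono (by omega) fun _ h => h

section Tables

variable {σ : Type} [FinEnum σ]

theorem ncard_le_card (X : Set σ) : X.ncard ≤ FinEnum.card σ := by
  rw [FinEnum.card_eq_fintypeCard, ← Nat.card_eq_fintype_card, ← Set.ncard_univ]
  exact Set.ncard_le_ncard (Set.subset_univ X)

theorem ncard_toSet_lt {A B : σ → Bool} (h : toSet A ⊆ toSet B) (hne : A ≠ B) :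
    (toSet A).ncard < (toSet B).ncard := by
  refine Set.ncard_lt_ncard (h.ssubset_of_ne fun e => hne (funext fun x => ?_))
  rw [Bool.eq_iff_iff]
  exact Set.ext_iff.1 e x

theorem returns_computeMt (I : Input σ) (ms₂ : σ → Bool) :
    Returns (computeMt I ms₂) (FinEnum.card σ * (FinEnum.card σ * 6)) fun mt =>
      ∀ s t, mt (s, t) = true ↔ I.δb (s, t) = true ∨ I.δr (s, t) = true ∨ ms₂ t = true :=
  returns_relT fun _ _ => (decides_readAt _ _).or ((decides_readAt _ _).or (decides_readAt _ _))

theorem returns_ensureClosure (δ : σ × σ → Bool) (S : σ → Bool) :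
    Returns (ensureClosure δ S) (FinEnum.card σ * (FinEnum.card σ * 8)) fun δ' =>
      ∀ s t, δ' (s, t) = true ↔ δ (s, t) = true ∧ ¬ (S s = true ∧ ¬ S t = true) :=
  returns_relT fun _ _ => (decides_readAt _ _).and
    ((decides_readAt _ _).and (decides_readAt _ _).not).not

/-- A pass removes only states that no live subset of `S` can contain, so all live subsets survive.
When a pass changes nothing, the current set has passed both tests and is itself live. -/
theorem returns_removeDeadlock (S : σ → Bool) (δp δe : σ × σ → Bool) :
    Returns (removeDeadlock S δp δe) (100 * (FinEnum.card σ + 1) ^ 3) fun X =>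
      IsGreatest {Y | Y ⊆ toSet S ∧ IsLive (toSet δp) (toSet δe) Y} (toSet X) := by
  -- The exact cost stays a metavariable that is filled in while the program is traversed; the last
  -- goal compares it with the stated bound.
  apply Returns.mono (hQR := fun _ h => h)
  apply returns_loopT (N := FinEnum.card σ)
    (Inv := fun X => toSet X ⊆ toSet S ∧
      ∀ Y, Y ⊆ toSet S → IsLive (toSet δp) (toSet δe) Y → Y ⊆ toSet X)
    (μ := fun X => (toSet X).ncard)
    (Q := fun X => IsGreatest {Y | Y ⊆ toSet S ∧ IsLive (toSet δp) (toSet δe) Y} (toSet X))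
  on_goal 3 =>
    intro X hX
    apply Returns.bind (returns_setT fun (s : σ) => (decides_readAt _ _).and
      (decides_existsT fun (t : σ) => (decides_readAt _ _).and
        ((decides_readAt _ _).or (decides_readAt _ _))))
    intro X₁ hX₁
    apply Returns.bind (returns_setT fun (s : σ) => (decides_readAt _ _).and
      (decides_existsT fun (t : σ) => (decides_readAt _ _).and (decides_readAt _ _).not).not)
    intro X₂ hX₂
    apply Returns.bind (decides_eqT _ _)
    intro b hb
    refine Returns.pure ?_
    have hle₁ : toSet X₁ ⊆ toSet X := fun s hs => ((hX₁ s).1 hs).1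
    have hle₂ : toSet X₂ ⊆ toSet X₁ := fun s hs => ((hX₂ s).1 hs).1
    have hmax : ∀ Y, Y ⊆ toSet S → IsLive (toSet δp) (toSet δe) Y → Y ⊆ toSet X₂ := by
      intro Y hYS hY
      have hYX := hX.2 Y hYS hY
      have hY₁ : Y ⊆ toSet X₁ := fun s hs => by
        obtain ⟨t, ht, hst⟩ := hY.live s hs
        exact (hX₁ s).2 ⟨hYX hs, t, hYX ht, hst⟩
      refine fun s hs => (hX₂ s).2 ⟨hY₁ hs, ?_⟩
      rintro ⟨t, hst, ht⟩
      exact ht (hY₁ (hY.closed s t hst hs))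
    split_ifs with h
    · obtain rfl := hb.1 h
      refine ⟨⟨hX.1, fun s t hst hs => ?_, fun s hs => ?_⟩, fun Y hY => hmax Y hY.1 hY.2⟩
      · by_contra ht
        exact ((hX₂ s).1 hs).2 ⟨t, hst, fun h => ht (hle₁ h)⟩
      · obtain ⟨t, ht, hst⟩ := ((hX₁ s).1 (hle₂ hs)).2
        exact ⟨t, ht, hst⟩
    · exact ⟨⟨(hle₂.trans hle₁).trans hX.1, hmax⟩,
        ncard_toSet_lt (hle₂.trans hle₁) fun e => h (hb.2 e.symm)⟩
  · exact ⟨subset_rfl, fun _ h _ => h⟩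
  · exact ncard_le_card _
  · ring_nf
    nlinarith [Nat.zero_le (FinEnum.card σ), Nat.zero_le (FinEnum.card σ ^ 2),
      Nat.zero_le (FinEnum.card σ ^ 3)]

/-- `M₁` and `M₂` satisfy the rules for states from which the faults and the environment can
violate safety: always from `M₁`, and unless the program has priority from `M₂`. -/
structure IsUnsafePair (δe δb δr f : Trans σ) (M₁ M₂ : Set σ) : Prop where
  fault_bad : ∀ s t, (s, t) ∈ f → (s, t) ∈ δb → s ∈ M₁
  fault : ∀ s t, (s, t) ∈ f → t ∈ M₂ → s ∈ M₁
  trapped : ∀ s t, (s, t) ∈ δe → t ∈ M₁ ∨ (s, t) ∈ δb →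
    (∀ u, (s, u) ∈ δb ∨ (s, u) ∈ δr ∨ u ∈ M₂) → s ∈ M₁
  environment_bad : ∀ s t, (s, t) ∈ δe → (s, t) ∈ δb → s ∈ M₂
  environment : ∀ s t, (s, t) ∈ δe → t ∈ M₁ → s ∈ M₂
  le : M₁ ⊆ M₂

/-- `ms₂` and `mt` store the second component of the least unsafe pair and the transitions that
the program must avoid because of it. -/
structure IsLeastUnsafe (I : Input σ) (ms₂ : σ → Bool) (mt : σ × σ → Bool) : Prop where
  exists_unsafePair :
    ∃ M₁, IsUnsafePair (toSet I.δe) (toSet I.δb) (toSet I.δr) (toSet I.f) M₁ (toSet ms₂)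
  least : ∀ M₁ M₂, IsUnsafePair (toSet I.δe) (toSet I.δb) (toSet I.δr) (toSet I.f) M₁ M₂ →
    toSet ms₂ ⊆ M₂
  mt_iff : ∀ s t, mt (s, t) = true ↔ I.δb (s, t) = true ∨ I.δr (s, t) = true ∨ ms₂ t = true

/-- The invariant of the loop that computes the least unsafe pair. -/
structure IsUnsafeApprox (I : Input σ) (ms₁ ms₂ : σ → Bool) (mt : σ × σ → Bool) : Prop where
  fault_bad : ∀ s t, I.f (s, t) = true → I.δb (s, t) = true → ms₁ s = true
  environment_bad : ∀ s t, I.δe (s, t) = true → I.δb (s, t) = true → ms₂ s = true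
  le_least : ∀ M₁ M₂, IsUnsafePair (toSet I.δe) (toSet I.δb) (toSet I.δr) (toSet I.f) M₁ M₂ →
    toSet ms₁ ⊆ M₁ ∧ toSet ms₂ ⊆ M₂
  mt_iff : ∀ s t, mt (s, t) = true ↔ I.δb (s, t) = true ∨ I.δr (s, t) = true ∨ ms₂ t = true

/-- Every state that a pass adds is forced into every unsafe pair by one of the rules, which gives
minimality. When a pass adds nothing, the tables satisfy all the rules. -/
theorem returns_computeMs (I : Input σ) :
    Returns (computeMs I) (1000 * (FinEnum.card σ + 1) ^ 3) fun v => IsLeastUnsafe I v.1 v.2 := by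
  unfold computeMs
  apply Returns.mono (hQR := fun _ h => h)
  apply Returns.bind (returns_setT fun (s : σ) => decides_existsT fun (t : σ) =>
      (decides_readAt _ _).and (decides_readAt _ _))
  intro m₁ hm₁
  apply Returns.bind (returns_setT fun (s : σ) => (decides_readAt _ _).or
    (decides_existsT fun (t : σ) => (decides_readAt _ _).and (decides_readAt _ _)))
  intro m₂ hm₂
  apply Returns.bind (returns_computeMt I m₂)
  intro mt hmt
  apply returns_loopT (N := 2 * FinEnum.card σ)
    (Inv := fun v : (σ → Bool) × (σ → Bool) × (σ × σ → Bool) =>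
      IsUnsafeApprox I v.1 v.2.1 v.2.2)
    -- A pass that does not exit enlarges at least one of the two tables; hence the sum of the
    -- complements, and the bound by twice the number of states.
    (μ := fun v : (σ → Bool) × (σ → Bool) × (σ × σ → Bool) =>
       (toSet v.1)ᶜ.ncard + (toSet v.2.1)ᶜ.ncard)
    (Q := fun v : (σ → Bool) × (σ × σ → Bool) => IsLeastUnsafe I v.1 v.2)
  on_goal 3 =>
    intro v hv
    apply Returns.bind (returns_setT fun (s : σ) => (decides_readAt _ _).or
      ((decides_existsT fun (t : σ) => (decides_readAt _ _).and (decides_readAt _ _)).or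
        ((decides_existsT fun (t : σ) => ((decides_readAt _ _).and (decides_readAt _ _)).or
          ((decides_readAt _ _).and (decides_readAt _ _))).and
          (decides_forallT fun (u : σ) => decides_readAt _ _))))
    intro n₁ hn₁
    apply Returns.bind (returns_setT fun (s : σ) => (decides_readAt _ _).or
      ((decides_readAt _ _).or (decides_existsT fun (t : σ) =>
        (decides_readAt _ _).and (decides_readAt _ _))))
    intro n₂ hn₂
    apply Returns.bind (returns_computeMt I n₂)
    intro nt hnt
    apply Returns.bind ((decides_eqT _ _).and (decides_eqT _ _))
    intro b hb
    refine Returns.pure ?_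
    obtain ⟨k₁, k₂, kt⟩ := v
    dsimp only at hv hn₁ hn₂ hb ⊢
    have hle₁ : ∀ s, k₁ s = true → n₁ s = true := fun s hs => (hn₁ s).2 (Or.inl hs)
    have hle₂ : ∀ s, k₂ s = true → n₂ s = true := fun s hs => (hn₂ s).2 (Or.inl hs)
    have hleast : ∀ M₁ M₂,
        IsUnsafePair (toSet I.δe) (toSet I.δb) (toSet I.δr) (toSet I.f) M₁ M₂ →
        toSet n₁ ⊆ M₁ ∧ toSet n₂ ⊆ M₂ := by
      intro M₁ M₂ hM
      obtain ⟨hk₁, hk₂⟩ := hv.le_least M₁ M₂ hM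
      have h₁ : toSet n₁ ⊆ M₁ := by
        intro s hs
        rcases (hn₁ s).1 hs with h | ⟨t, ht, hst⟩ | ⟨⟨t, ht⟩, hall⟩
        · exact hk₁ h
        · exact hM.fault s t hst (hk₂ ht)
        · have hall' : ∀ u, (s, u) ∈ toSet I.δb ∨ (s, u) ∈ toSet I.δr ∨ u ∈ M₂ := fun u =>
            ((hv.mt_iff s u).1 (hall u)).imp_right (Or.imp_right fun h => hk₂ h)
          rcases ht with ⟨ht, hst⟩ | ⟨hst, hb⟩
          · exact hM.trapped s t hst (Or.inl (hk₁ ht)) hall'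
          · exact hM.trapped s t hst (Or.inr hb) hall'
      refine ⟨h₁, fun s hs => ?_⟩
      rcases (hn₂ s).1 hs with h | h | ⟨t, ht, hst⟩
      · exact hk₂ h
      · exact hM.le (h₁ h)
      · exact hM.environment s t hst (h₁ ht)
    split_ifs with h
    · obtain ⟨rfl, rfl⟩ := hb.1 h
      refine ⟨⟨toSet k₁, hv.fault_bad, fun s t hst ht => ?_, fun s t hst ht hall => ?_,
        hv.environment_bad, fun s t hst ht => ?_, fun s hs => ?_⟩, fun M₁ M₂ hM =>
        (hleast M₁ M₂ hM).2, hnt⟩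
      · exact (hn₁ s).2 (Or.inr (Or.inl ⟨t, ht, hst⟩))
      · exact (hn₁ s).2 (Or.inr (Or.inr ⟨⟨t, ht.imp (fun h => ⟨h, hst⟩) fun h => ⟨hst, h⟩⟩,
          fun u => (hv.mt_iff s u).2 (hall u)⟩))
      · exact (hn₂ s).2 (Or.inr (Or.inr ⟨t, ht, hst⟩))
      · exact (hn₂ s).2 (Or.inr (Or.inl hs))
    · refine ⟨⟨fun s t hf hd => hle₁ s (hv.fault_bad s t hf hd),
        fun s t he hd => hle₂ s (hv.environment_bad s t he hd), hleast, hnt⟩, ?_⟩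
      have hc₁ : (toSet n₁)ᶜ.ncard ≤ (toSet k₁)ᶜ.ncard :=
        Set.ncard_le_ncard (Set.compl_subset_compl.2 hle₁)
      have hc₂ : (toSet n₂)ᶜ.ncard ≤ (toSet k₂)ᶜ.ncard :=
        Set.ncard_le_ncard (Set.compl_subset_compl.2 hle₂)
      have key : ∀ A B : σ → Bool, (∀ s, A s = true → B s = true) → A ≠ B →
          (toSet B)ᶜ.ncard < (toSet A)ᶜ.ncard := by
        intro A B hAB hne
        have h₁ := ncard_toSet_lt hAB hne
        have h₂ := Set.ncard_add_ncard_compl (toSet A)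
        have h₃ := Set.ncard_add_ncard_compl (toSet B)
        omega
      rcases not_and_or.1 fun e => h (hb.2 e) with hne | hne
      · have := key k₁ n₁ hle₁ hne
        dsimp only
        omega
      · have := key k₂ n₂ hle₂ hne
        dsimp only
        omega
  · refine ⟨fun s t hf hd => (hm₁ s).2 ⟨t, hf, hd⟩,
      fun s t he hd => (hm₂ s).2 (Or.inr ⟨t, he, hd⟩), fun M₁ M₂ hM => ?_, hmt⟩
    have h₁ : toSet m₁ ⊆ M₁ := fun s hs => by
      obtain ⟨t, hf, hd⟩ := (hm₁ s).1 hs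
      exact hM.fault_bad s t hf hd
    refine ⟨h₁, fun s hs => ?_⟩
    rcases (hm₂ s).1 hs with h | ⟨t, he, hd⟩
    · exact hM.le (h₁ h)
    · exact hM.environment_bad s t he hd
  · have h₁ := ncard_le_card (toSet m₁)ᶜ
    have h₂ := ncard_le_card (toSet m₂)ᶜ
    dsimp only
    omega
  · ring_nf
    nlinarith [Nat.zero_le (FinEnum.card σ), Nat.zero_le (FinEnum.card σ ^ 2),
      Nat.zero_le (FinEnum.card σ ^ 3)]

/-- `X` lies in `A`, is live, and the environment cannot lead from `X` to a state where `δp` has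
priority over the environment but `δ` has no transition into `X`. -/
structure IsAdmissible (δ δp δe : Trans σ) (A X : Set σ) : Prop where
  subset : X ⊆ A
  live : IsLive δp δe X
  enabled : ∀ s ∈ X, ∀ t, (s, t) ∈ δe → Enabled δe t → Enabled δp t → ∃ u ∈ X, (t, u) ∈ δ

/-- The transitions that the program must not have: they are bad, restricted or lead into `M`. -/
def avoided (δb δr : Trans σ) (M : Set σ) : Trans σ :=
  {p | p ∈ δb ∨ p ∈ δr ∨ p.2 ∈ M}

/-- The transitions of `δp` inside `S` that are not in `mt`. -/
def safeProgram (δp : Trans σ) (S : Set σ) (mt : Trans σ) : Trans σ :=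
  {p | (p ∈ δp ∧ p.1 ∈ S ∧ p.2 ∈ S) ∧ p ∉ mt}

/-- The program that executes `δ` inside `X` and is only restricted by `mt` elsewhere. -/
def extendProgram (δ mt : Trans σ) (X : Set σ) : Trans σ :=
  {p | (p.1 ∈ X → p ∈ δ ∧ p.2 ∈ X) ∧ p ∉ mt}

/-- What the algorithm returns when `M` is the set of states that become unsafe when the
environment may execute. -/
def IsOutput (I : Input σ) (M : Set σ) (res : Option ((σ × σ → Bool) × (σ → Bool))) : Prop :=
  let mt := avoided (toSet I.δb) (toSet I.δr) M
  let δ₀ := safeProgram (toSet I.δp) (toSet I.S) mt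
  match res with
  | none => ∀ Y, IsLive δ₀ (toSet I.δe) Y →
    IsAdmissible δ₀ (toSet I.δp) (toSet I.δe) (toSet I.S \ M) Y → Y = ∅
  | some (δ, X) => (toSet X).Nonempty ∧
    IsAdmissible δ₀ (toSet I.δp) (toSet I.δe) (toSet I.S \ M) (toSet X) ∧
    toSet δ = extendProgram δ₀ mt (toSet X)

/-- The third phase keeps every live and admissible `Y` inside the current invariant. Liveness of
`Y` for `δ₀` is needed only to survive the initial deadlock removal; the later ones use `δp`. -/
theorem returns_addFailsafe (I : Input σ) :
    Returns (addFailsafe I) (10000 * (FinEnum.card σ + 1) ^ 4) fun res =>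
      ∃ M₁ M₂, IsUnsafePair (toSet I.δe) (toSet I.δb) (toSet I.δr) (toSet I.f) M₁ M₂ ∧
        (∀ N₁ N₂, IsUnsafePair (toSet I.δe) (toSet I.δb) (toSet I.δr) (toSet I.f) N₁ N₂ →
          M₂ ⊆ N₂) ∧
        IsOutput I M₂ res := by
  unfold addFailsafe
  apply Returns.mono (hQR := fun _ h => h)
  apply Returns.bind (returns_computeMs I)
  rintro ⟨ms₂, tmt⟩ hv
  dsimp only at hv ⊢
  apply Returns.bind (returns_relT fun (s : σ) (t : σ) => ((decides_readAt _ _).and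
    ((decides_readAt _ _).and (decides_readAt _ _))).and (decides_readAt _ _).not)
  intro t₀ ht₀
  apply Returns.bind (returns_setT fun (s : σ) => (decides_readAt _ _).and
    (decides_readAt _ _).not)
  intro A hA
  apply Returns.bind (returns_removeDeadlock A t₀ I.δe)
  intro S₀ hS₀
  set M := toSet ms₂ with hM
  set mt := avoided (toSet I.δb) (toSet I.δr) M with hmt
  set δ₀ := safeProgram (toSet I.δp) (toSet I.S) mt with hδ₀
  have hmt_iff : ∀ p, tmt p = true ↔ p ∈ mt := fun p => hv.mt_iff p.1 p.2
  have hAM : toSet A = toSet I.S \ M := Set.ext hA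
  have htδ₀ : toSet t₀ = δ₀ := by
    ext ⟨s, t⟩
    refine (ht₀ s t).trans ?_
    rw [hmt_iff]
    rfl
  rw [htδ₀, hAM] at hS₀
  apply Returns.bind (Q := fun res : Option ((σ × σ → Bool) × (σ → Bool)) =>
    match res with
    | none => ∀ Y, IsLive δ₀ (toSet I.δe) Y →
      IsAdmissible δ₀ (toSet I.δp) (toSet I.δe) (toSet I.S \ M) Y → Y = ∅
    | some (δ, X) => (toSet X).Nonempty ∧
      IsAdmissible δ₀ (toSet I.δp) (toSet I.δe) (toSet I.S \ M) (toSet X) ∧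
      ∀ s ∈ toSet X, ∀ t, (s, t) ∈ toSet δ ↔ (s, t) ∈ δ₀ ∧ t ∈ toSet X)
  · apply returns_loopT (N := FinEnum.card σ)
      -- Only transitions leaving some earlier, larger invariant have been deleted, so between
      -- states of the current one the program still agrees with `δ₀`.
      (Inv := fun w : (σ × σ → Bool) × (σ → Bool) => toSet w.2 ⊆ toSet I.S \ M ∧
        toSet w.1 ⊆ δ₀ ∧
        (∀ s ∈ toSet w.2, ∀ t ∈ toSet w.2, (s, t) ∈ δ₀ → (s, t) ∈ toSet w.1) ∧
        ∀ Y, IsLive δ₀ (toSet I.δe) Y →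
          IsAdmissible δ₀ (toSet I.δp) (toSet I.δe) (toSet I.S \ M) Y → Y ⊆ toSet w.2)
      (μ := fun w : (σ × σ → Bool) × (σ → Bool) => (toSet w.2).ncard)
    on_goal 3 =>
      rintro ⟨δ, S⟩ ⟨hSA, hδ, hδS, hmax⟩
      dsimp only at hSA hδ hδS hmax ⊢
      apply Returns.bind (decides_existsT fun (s : σ) => decides_readAt _ _)
      intro b hb
      apply Returns.ite
      · intro hbt
        apply Returns.bind (returns_ensureClosure δ S)
        intro δ' hδ'
        apply Returns.bind (returns_setT fun (s : σ) =>
          ((decides_existsT fun (t : σ) => decides_readAt _ _).and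
            (decides_existsT fun (t : σ) => decides_readAt _ _)).and
          (decides_existsT fun (t : σ) => decides_readAt _ _).not)
        intro ms₃ hms₃
        apply Returns.bind (returns_setT fun (s : σ) => decides_existsT fun (t : σ) =>
          (decides_readAt _ _).and (decides_readAt _ _))
        intro ms₄ hms₄
        apply Returns.bind (returns_setT fun (s : σ) => (decides_readAt _ _).and
          (decides_readAt _ _).not)
        intro B hB
        apply Returns.bind (returns_removeDeadlock B I.δp I.δe)
        intro S' hS'
        apply Returns.bind (decides_eqT S S')
        intro b' hb'
        refine Returns.pure ?_
        have hBS : toSet B ⊆ toSet S := fun s hs => ((hB s).1 hs).1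
        have hS'S : toSet S' ⊆ toSet S := hS'.1.1.trans hBS
        have hδ'δ : toSet δ' ⊆ δ₀ := fun p hp => hδ ((hδ' p.1 p.2).1 hp).1
        have hδ'S : ∀ s ∈ toSet S, ∀ t ∈ toSet S, (s, t) ∈ δ₀ → (s, t) ∈ toSet δ' :=
          fun s hs t ht h => (hδ' s t).2 ⟨hδS s hs t ht h, fun h => h.2 ht⟩
        split_ifs with h
        · obtain rfl := hb'.1 h
          have hδ'_iff : ∀ s ∈ toSet S, ∀ t, (s, t) ∈ toSet δ' ↔ (s, t) ∈ δ₀ ∧ t ∈ toSet S := by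
            refine fun s hs t => ⟨fun h => ⟨hδ'δ h, ?_⟩, fun h => hδ'S s hs t h.2 h.1⟩
            by_contra ht
            exact ((hδ' s t).1 h).2 ⟨hs, ht⟩
          refine ⟨hb.1 hbt, ⟨hSA, hS'.1.2, fun s hs t hst het hpt => ?_⟩, hδ'_iff⟩
          have ht : t ∈ toSet S := hS'.1.2.closed s t hst hs
          by_contra hno
          -- Otherwise `t` would lie in `ms₃` and `s` in `ms₄`, but the stable invariant is
          -- contained in `B`, which avoids `ms₄`.
          refine ((hB s).1 (hS'.1.1 hs)).2 ((hms₄ s).2 ⟨t, (hms₃ t).2 ⟨⟨het, hpt⟩, ?_⟩, hst⟩)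
          rintro ⟨u, htu⟩
          have hu := (hδ'_iff t ht u).1 htu
          exact hno ⟨u, hu.2, hu.1⟩
        · refine ⟨⟨hS'S.trans hSA, hδ'δ, fun s hs t ht => hδ'S s (hS'S hs) t (hS'S ht),
            fun Y hY hYA => ?_⟩, ncard_toSet_lt hS'S fun e => h (hb'.2 e.symm)⟩
          have hYS := hmax Y hY hYA
          refine hS'.2 ⟨fun s hs => (hB s).2 ⟨hYS hs, fun hs₄ => ?_⟩, hYA.live⟩
          obtain ⟨t, ht₃, hst⟩ := (hms₄ s).1 hs₄
          obtain ⟨⟨het, hpt⟩, hno⟩ := (hms₃ t).1 ht₃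
          -- The transition that admissibility provides stays inside `Y`, so closing the program
          -- cannot have deleted it.
          obtain ⟨u, hu, htu⟩ := hYA.enabled s hs t hst het hpt
          exact hno ⟨u, hδ'S t (hYS (hYA.live.closed s t hst hs)) u (hYS hu) htu⟩
      · intro hbf
        refine Returns.pure fun Y hY hYA => Set.eq_empty_of_forall_notMem fun s hs => ?_
        exact hbf (hb.2 ⟨s, hmax Y hY hYA hs⟩)
    · exact ⟨hS₀.1.1, htδ₀.le, fun s _ t _ h => htδ₀.ge h,
        fun Y hY hYA => hS₀.2 ⟨hYA.subset, hY⟩⟩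
    · exact ncard_le_card _
  · intro res hres
    obtain ⟨M₁, hM₁⟩ := hv.exists_unsafePair
    rcases res with _ | ⟨δ, X⟩
    on_goal 2 =>
      apply Returns.bind (returns_relT fun (s : σ) (t : σ) => ((decides_readAt _ _).or
        (decides_readAt _ _).not).and (decides_readAt _ _).not)
      intro δ' hδ'
      refine Returns.pure ⟨M₁, M, hM₁, hv.least, hres.1, hres.2.1, ?_⟩
      ext ⟨s, t⟩
      refine (hδ' s t).trans ?_
      rw [hmt_iff]
      -- Outside `X` both sides allow everything but `mt`, so `δ` matters only at states of `X`.
      refine and_congr_left fun _ => ⟨fun h hs => ?_, fun h => ?_⟩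
      · exact (hres.2.2 s hs t).1 (h.resolve_right fun h' => h' hs)
      · by_cases hs : s ∈ toSet X
        · exact Or.inl ((hres.2.2 s hs t).2 (h hs))
        · exact Or.inr hs
    · exact (Returns.pure ⟨M₁, M, hM₁, hv.least, hres⟩).mono (Nat.zero_le _) fun _ h => h
  · ring_nf
    nlinarith [Nat.zero_le (FinEnum.card σ), Nat.zero_le (FinEnum.card σ ^ 2),
      Nat.zero_le (FinEnum.card σ ^ 3), Nat.zero_le (FinEnum.card σ ^ 4)]

end Tables

end FailsafeTolerance

namespace FailsafeTolerance

/-! ## Construction of computations -/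

section Runs

variable {σ : Type}

/-- The step from `s` to the first state of `r`, executed by `a`, followed by `r`. -/
def Run.cons (s : σ) (a : Actor) (r : Run σ) : Run σ where
  steps := r.steps + 1
  state i := match i with
    | 0 => s
    | i + 1 => r.state i
  actor i := match i with
    | 0 => a
    | i + 1 => r.actor i

theorem Run.succ_lt_steps_cons {s : σ} {a : Actor} {r : Run σ} {i : ℕ} :
    ((i + 1 : ℕ) : ℕ∞) < (r.cons s a).steps ↔ (i : ℕ∞) < r.steps := by
  change _ < r.steps + 1 ↔ _
  rw [Nat.cast_add, Nat.cast_one]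
  exact ENat.add_lt_add_iff_right ENat.one_ne_top

theorem Run.zero_lt_steps_cons {s : σ} {a : Actor} {r : Run σ} :
    ((0 : ℕ) : ℕ∞) < (r.cons s a).steps := by
  change _ < r.steps + 1
  exact lt_of_lt_of_le (by simp) le_add_self

/-- `a` may execute a step of the program `δp` in the environment `δe` with the faults `f` along
the transition `e`. -/
def IsStep (δp δe f : Trans σ) (a : Actor) (e : σ × σ) : Prop :=
  (a = Actor.program ∧ e ∈ δp) ∨ (a = Actor.environment ∧ e ∈ δe) ∨ (a = Actor.fault ∧ e ∈ f)

/-- `r` may directly follow an environment step: it does not start with an environment step when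
the program can execute. -/
def Yields (δp : Trans σ) (r : Run σ) : Prop :=
  ((0 : ℕ) : ℕ∞) < r.steps → r.actor 0 = Actor.environment → ¬ Enabled δp (r.state 0)

/-- For fairness parameter 2, an environment step constrains only the next step, so prepending a
step needs a condition on the first step of `r` alone. -/
theorem IsFaultComputation.cons {δp δe f : Trans σ} {r : Run σ}
    (hr : IsFaultComputation 2 δp δe f r) {s : σ} {a : Actor}
    (h : IsStep δp δe f a (s, r.state 0)) (hy : a = Actor.environment → Yields δp r) :
    IsFaultComputation 2 δp δe f (r.cons s a) where
  step i hi := by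
    cases i with
    | zero => exact h
    | succ i => exact hr.step i (Run.succ_lt_steps_cons.1 hi)
  fair i hi hact l hil hli hl hen := by
    obtain rfl : l = i + 1 := by omega
    have hl' := Run.succ_lt_steps_cons.1 hl
    cases i with
    | zero =>
      rcases hr.step 0 hl' with h0 | h0 | h0
      · exact Or.inl h0.1
      · exact absurd hen (hy hact hl' h0.1)
      · exact Or.inr h0.1
    | succ i =>
      exact hr.fair i (Run.succ_lt_steps_cons.1 hi) hact (i + 1) (by omega) (by omega) hl' hen
  finite_faults := by
    obtain ⟨n, hn⟩ := hr.finite_faults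
    refine ⟨n + 1, fun j hj hjs => ?_⟩
    cases j with
    | zero => omega
    | succ j => exact hn j (by omega) (Run.succ_lt_steps_cons.1 hjs)
  maximal n hn := by
    change r.steps + 1 = n at hn
    cases n with
    | zero => simp at hn
    | succ n =>
      refine hr.maximal n ?_
      rw [Nat.cast_add, Nat.cast_one] at hn
      exact (WithTop.add_right_inj ENat.one_ne_top).1 hn

/-- From every state there is a fault-free computation in which the environment only executes
when the program cannot. -/
theorem exists_computation (δp δe f : Trans σ) (s : σ) :
    ∃ r : Run σ, r.state 0 = s ∧ IsFaultComputation 2 δp δe f r ∧ Yields δp r := by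
  classical
  let act : σ → Actor := fun s => if Enabled δp s then Actor.program else Actor.environment
  have hact : ∀ s, act s = Actor.environment → ¬ Enabled δp s := by
    intro s h hen
    simp [act, hen] at h
  have hnext : ∀ s, ∃ s', Enabled (δp ∪ δe) s →
      (act s = Actor.program ∧ (s, s') ∈ δp) ∨ (act s = Actor.environment ∧ (s, s') ∈ δe) := by
    intro s
    by_cases hp : Enabled δp s
    · exact ⟨hp.choose, fun _ => Or.inl ⟨by simp [act, hp], hp.choose_spec⟩⟩
    · by_cases he : Enabled δe s
      · exact ⟨he.choose, fun _ => Or.inr ⟨by simp [act, hp], he.choose_spec⟩⟩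
      -- At a deadlock the successor is a dummy value; the run is cut off there by the choice of
      -- `N`.
      · refine ⟨s, fun h => ?_⟩
        obtain ⟨s', h' | h'⟩ := h
        · exact absurd ⟨s', h'⟩ hp
        · exact absurd ⟨s', h'⟩ he
  choose next hnext using hnext
  let st : ℕ → σ := fun i => next^[i] s
  have hst : ∀ i, st (i + 1) = next (st i) := fun i => Function.iterate_succ_apply' next i s
  obtain ⟨N, hN, hNmax⟩ : ∃ N : ℕ∞, (∀ i : ℕ, (i : ℕ∞) < N → Enabled (δp ∪ δe) (st i)) ∧
      ∀ n : ℕ, N = n → ¬ Enabled (δp ∪ δe) (st n) := by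
    by_cases h : ∃ n, ¬ Enabled (δp ∪ δe) (st n)
    · refine ⟨(Nat.find h : ℕ), fun i hi => ?_, fun n hn => ?_⟩
      · exact not_not.1 (Nat.find_min h (Nat.cast_lt.1 hi))
      · rw [← Nat.cast_inj.1 hn]
        exact Nat.find_spec h
    · push Not at h
      exact ⟨⊤, fun i _ => h i, fun n hn => absurd hn (by simp)⟩
  have hstep : ∀ i : ℕ, (i : ℕ∞) < N →
      (act (st i) = Actor.program ∧ (st i, st (i + 1)) ∈ δp) ∨
      (act (st i) = Actor.environment ∧ (st i, st (i + 1)) ∈ δe) := by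
    intro i hi
    rw [hst]
    exact hnext (st i) (hN i hi)
  refine ⟨⟨N, st, fun i => act (st i)⟩, rfl, ⟨fun i hi => ?_, fun i hi _ l _ _ hl hen => ?_,
    ⟨0, fun j _ hj => ?_⟩, hNmax⟩, fun _ h => hact _ h⟩
  · rcases hstep i hi with h | h
    exacts [Or.inl h, Or.inr (Or.inl h)]
  · rcases hstep l hl with h | h
    exacts [Or.inl h.1, absurd hen (hact _ h.1)]
  · rcases hstep j hj with h | h <;> simp [h.1]

/-- This lets the constructions for runs with faults serve for ordinary computations too, by taking
`f = ∅`. -/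
theorem IsFaultComputation.isComputation {δp δe : Trans σ} {r : Run σ}
    (hr : IsFaultComputation 2 δp δe ∅ r) : IsComputation 2 δp δe r where
  step i hi := by
    rcases hr.step i hi with h | h | h
    exacts [Or.inl h, Or.inr h, h.2.elim]
  fair i hi hact l hil hli hl hen := by
    rcases hr.fair i hi hact l hil hli hl hen with h | h
    · exact h
    · rcases hr.step l hl with h' | h' | h'
      · exact h'.1
      · exact absurd (h.symm.trans h'.1) (by simp)
      · exact h'.2.elim
  maximal := hr.maximal

/-- Every program or environment transition is the first step of a computation. -/
theorem exists_computation_step {δp δe : Trans σ} {a : Actor} {s t : σ}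
    (h : IsStep δp δe ∅ a (s, t)) :
    ∃ r : Run σ, IsComputation 2 δp δe r ∧ ((0 : ℕ) : ℕ∞) < r.steps ∧ r.state 0 = s ∧
      r.state 1 = t ∧ r.actor 0 = a := by
  obtain ⟨r, rfl, hr, hy⟩ := exists_computation δp δe ∅ t
  exact ⟨r.cons s a, (hr.cons h fun _ => hy).isComputation, Run.zero_lt_steps_cons, rfl, rfl, rfl⟩

/-- Two environment transitions in a row start a computation if the program is disabled in
between. -/
theorem exists_computation_environment {δp δe : Trans σ} {s t u : σ} (hst : (s, t) ∈ δe)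
    (htu : (t, u) ∈ δe) (ht : ¬ Enabled δp t) :
    ∃ r : Run σ, IsComputation 2 δp δe r ∧ ((1 : ℕ) : ℕ∞) < r.steps ∧ r.state 0 = s ∧
      r.state 1 = t ∧ r.actor 0 = Actor.environment ∧ r.actor 1 = Actor.environment := by
  obtain ⟨r, rfl, hr, hy⟩ := exists_computation δp δe ∅ u
  have h₁ := hr.cons (s := t) (a := Actor.environment) (Or.inr (Or.inl ⟨rfl, htu⟩)) fun _ => hy
  have h₂ := h₁.cons (s := s) (a := Actor.environment) (Or.inr (Or.inl ⟨rfl, hst⟩))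
    fun _ _ _ => ht
  exact ⟨_, h₂.isComputation, Run.succ_lt_steps_cons.2 Run.zero_lt_steps_cons, rfl, rfl, rfl, rfl⟩

/-- The transition is the first step of some computation from `S`, to which safety applies. -/
theorem Refines.notMem_bad {δp δe : Trans σ} {spec : Spec σ} {S : Set σ}
    (h : Refines 2 δp δe spec S) {s t : σ} (hs : s ∈ S) (hst : (s, t) ∈ δp) :
    (s, t) ∉ spec.bad := by
  obtain ⟨r, hr, h0, rfl, rfl, -⟩ :=
    exists_computation_step (δe := δe) (a := Actor.program) (Or.inl ⟨rfl, hst⟩)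
  exact (h.2 r hr hs).1 0 h0

end Runs

end FailsafeTolerance

namespace FailsafeTolerance

/-! ## Soundness and completeness -/

section Correctness

variable {σ : Type} {δp δe δb δr f : Trans σ} {S X M₁ M₂ : Set σ}

theorem IsClosedIn.state_mem {k : ℕ} (hX : IsClosedIn X (δp ∪ δe)) {r : Run σ}
    (hr : IsComputation k δp δe r) (h0 : r.state 0 ∈ X) :
    ∀ i : ℕ, (i : ℕ∞) ≤ r.steps → r.state i ∈ X
  | 0, _ => h0
  | i + 1, hi => by
    have hlt : (i : ℕ∞) < r.steps := lt_of_lt_of_le (by exact_mod_cast Nat.lt_succ_self i) hi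
    exact hX _ _ ((hr.step i hlt).imp And.right And.right) (hX.state_mem hr h0 i hlt.le)

/-- A run in the presence of faults does not violate safety if it starts outside the second
component of an unsafe pair and the program avoids that component but has all other harmless
transitions from it. -/
theorem IsFaultComputation.refinesSafety (hM : IsUnsafePair δe δb δr f M₁ M₂)
    (hδ : ∀ p ∈ δp, p ∉ avoided δb δr M₂)
    (hen : ∀ s ∈ M₂, ∀ t, (s, t) ∉ avoided δb δr M₂ → (s, t) ∈ δp) {r : Run σ}
    (hr : IsFaultComputation 2 δp δe f r) (h0 : r.state 0 ∉ M₂) : RefinesSafety δb r := by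
  -- The invariant along the run: `M₁` is never reached, and `M₂` only directly after an environment
  -- step, when the program has priority.
  let P : ℕ → Prop := fun i => r.state i ∉ M₁ ∧
    (r.state i ∈ M₂ → ∃ j, i = j + 1 ∧ r.actor j = Actor.environment)
  have hstep : ∀ i : ℕ, (i : ℕ∞) < r.steps → P i → r.edge i ∉ δb ∧ P (i + 1) := by
    rintro i hi ⟨h₁, h₂⟩
    rcases hr.step i hi with ⟨-, h⟩ | ⟨ha, h⟩ | ⟨-, h⟩
    · have hav := hδ _ h
      have hnot : r.state (i + 1) ∉ M₂ := fun h' => hav (Or.inr (Or.inr h'))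
      exact ⟨fun h' => hav (Or.inl h'), fun h' => hnot (hM.le h'), fun h' => absurd h' hnot⟩
    · have key : r.edge i ∉ δb ∧ r.state (i + 1) ∉ M₁ := by
        by_cases hs : r.state i ∈ M₂
        · obtain ⟨j, rfl, hj⟩ := h₂ hs
          -- Two environment steps in a row show that the program is disabled in between. Since it
          -- has all harmless transitions there, none exists, and the rule `trapped` would put the
          -- state into `M₁`.
          have hdis : ¬ Enabled δp (r.state (j + 1)) := fun he => by
            have hj' : (j : ℕ∞) < r.steps :=
              lt_trans (by exact_mod_cast Nat.lt_succ_self j) hi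
            rcases hr.fair j hj' hj (j + 1) (by omega) (by omega) hi he with h' | h' <;>
              simp [ha] at h'
          have htrap : ∀ u, (r.state (j + 1), u) ∈ δb ∨ (r.state (j + 1), u) ∈ δr ∨ u ∈ M₂ := by
            intro u
            by_contra hu
            exact hdis ⟨u, hen _ hs u hu⟩
          exact ⟨fun hb => h₁ (hM.trapped _ _ h (Or.inr hb) htrap),
            fun ht => h₁ (hM.trapped _ _ h (Or.inl ht) htrap)⟩
        · exact ⟨fun hb => hs (hM.environment_bad _ _ h hb),
            fun ht => hs (hM.environment _ _ h ht)⟩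
      exact ⟨key.1, key.2, fun _ => ⟨i, rfl, ha⟩⟩
    · have hnot : r.state (i + 1) ∉ M₂ := fun h' => h₁ (hM.fault _ _ h h')
      exact ⟨fun hb => h₁ (hM.fault_bad _ _ h hb), fun h' => hnot (hM.le h'),
        fun h' => absurd h' hnot⟩
  have hP : ∀ i : ℕ, (i : ℕ∞) ≤ r.steps → P i := by
    intro i
    induction i with
    | zero => exact fun _ => ⟨fun h => h0 (hM.le h), fun h => absurd h h0⟩
    | succ i ih =>
      intro hi
      have hlt : (i : ℕ∞) < r.steps := lt_of_lt_of_le (by exact_mod_cast Nat.lt_succ_self i) hi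
      exact (hstep i hlt (ih hlt.le)).2
  exact fun i hi => (hstep i hi (hP i hi.le)).1

/-- Soundness. -/
theorem IsAdmissible.isFailsafeAddition {L T : Set σ}
    (href : Refines 2 δp δe ⟨δb, L, T⟩ S) (hres : δp ∩ δr = ∅)
    (hM : IsUnsafePair δe δb δr f M₁ M₂)
    (hX : IsAdmissible (safeProgram δp S (avoided δb δr M₂)) δp δe (S \ M₂) X)
    (hne : X.Nonempty) :
    IsFailsafeAddition 2 δp δe f δr ⟨δb, L, T⟩ S
      (extendProgram (safeProgram δp S (avoided δb δr M₂)) (avoided δb δr M₂) X) X := by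
  set mt := avoided δb δr M₂ with hmt
  set δ' := extendProgram (safeProgram δp S mt) mt X with hδ'
  -- No old program transition inside `X` is lost: refinement excludes bad ones, `hres` restricted
  -- ones, and `X` is disjoint from `M₂`.
  have hmem : ∀ s ∈ X, ∀ t ∈ X, (s, t) ∈ δp → (s, t) ∈ δ' := by
    intro s hs t ht hst
    have hnot : (s, t) ∉ mt := by
      rintro (h | h | h)
      · exact href.notMem_bad (hX.subset hs).1 hst h
      · exact Set.notMem_empty _ (hres.subset ⟨hst, h⟩)
      · exact (hX.subset ht).2 h
    exact ⟨fun _ => ⟨⟨⟨hst, (hX.subset hs).1, (hX.subset ht).1⟩, hnot⟩, ht⟩, hnot⟩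
  have hclosed : IsClosedIn X (δ' ∪ δe) := by
    rintro s t (h | h) hs
    · exact (h.1 hs).2
    · exact hX.live.closed s t h hs
  have hc1 : ∀ r : Run σ, IsComputation 2 δ' δe r → r.state 0 ∈ X →
      IsComputation 2 δp δe r ∧ r.state 0 ∈ S := by
    intro r hr h0
    have hmemX := hclosed.state_mem hr h0
    refine ⟨⟨fun i hi => ?_, fun i hi ha l hil hli hl hen => ?_, fun n hn hen => ?_⟩,
      (hX.subset h0).1⟩
    · exact (hr.step i hi).imp_left fun h => ⟨h.1, (h.2.1 (hmemX i hi.le)).1.1.1⟩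
    · obtain rfl : l = i + 1 := by omega
      rcases hr.step (i + 1) hl with h | h
      · exact h.1
      · have he : r.edge i ∈ δe := by
          rcases hr.step i hi with h' | h'
          · exact absurd (ha.symm.trans h'.1) (by simp)
          · exact h'.2
        -- If the environment executes where the old program had priority, admissibility enables the
        -- new program as well, and its own fairness applies.
        obtain ⟨u, hu, htu⟩ := hX.enabled _ (hmemX i hi.le) _ he ⟨_, h.2⟩ hen
        exact hr.fair i hi ha (i + 1) hil hli hl ⟨u, hmem _ (hmemX _ hl.le) u hu htu.1.1⟩
    · have hs := hmemX n hn.ge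
      obtain ⟨t, ht, hst⟩ := hX.live.live _ hs
      exact hr.maximal n hn ⟨t, hst.imp_left fun h => hmem _ hs t ht h⟩
  refine ⟨hne, hc1, ⟨⟨hclosed, fun r hr h0 => ?_⟩, fun r hr h0 m hm j hj => ?_⟩, ?_⟩
  · obtain ⟨hr', h0'⟩ := hc1 r hr h0
    exact href.2 r hr' h0'
  · refine hr.refinesSafety hM (fun p hp => hp.2) ?_ (hX.subset h0).2 j (lt_of_lt_of_le hj hm)
    -- States of `M₂` lie outside `X`, where the new program is restricted by `mt` only.
    exact fun s hs t hst => ⟨fun h => absurd hs (hX.subset h).2, hst⟩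
  · refine Set.eq_empty_of_forall_notMem fun p hp => hp.1.2 (Or.inr (Or.inl hp.2))

/-- `r` is a computation from `s` in the presence of faults that violates safety. -/
structure Violates (δp δe f δb : Trans σ) (s : σ) (r : Run σ) : Prop where
  computation : IsFaultComputation 2 δp δe f r
  start : r.state 0 = s
  bad : ∃ j : ℕ, (j : ℕ∞) < r.steps ∧ r.edge j ∈ δb

theorem Violates.cons {s t : σ} {r : Run σ} (hr : Violates δp δe f δb t r) {a : Actor}
    (h : IsStep δp δe f a (s, t)) (hy : a = Actor.environment → Yields δp r) :
    Violates δp δe f δb s (r.cons s a) := by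
  obtain ⟨hc, rfl, j, hj, hb⟩ := hr
  exact ⟨hc.cons h hy, rfl, j + 1, Run.succ_lt_steps_cons.2 hj, hb⟩

/-- The first step already violates safety, so any continuation that yields will do. -/
theorem exists_violates_of_bad {s t : σ} {a : Actor} (h : IsStep δp δe f a (s, t))
    (hb : (s, t) ∈ δb) :
    ∃ r : Run σ, Violates δp δe f δb s (r.cons s a) := by
  obtain ⟨r, rfl, hr, hy⟩ := exists_computation δp δe f t
  exact ⟨r, hr.cons h fun _ => hy, rfl, 0, Run.zero_lt_steps_cons, hb⟩

theorem yields_cons {s : σ} {a : Actor} (r : Run σ)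
    (h : a = Actor.environment → ¬ Enabled δp s) : Yields δp (r.cons s a) :=
  fun _ ha => h ha

/-- The states from which safety can be violated form an unsafe pair. -/
theorem isUnsafePair_violates (hres : δp ∩ δr = ∅) :
    IsUnsafePair δe δb δr f {s | ∃ r, Violates δp δe f δb s r ∧ Yields δp r}
      {s | ∃ r, Violates δp δe f δb s r} where
  fault_bad s t hf hb := by
    obtain ⟨r, hr⟩ := exists_violates_of_bad (δp := δp) (δe := δe) (Or.inr (Or.inr ⟨rfl, hf⟩)) hb
    exact ⟨_, hr, yields_cons r (by simp)⟩
  fault s t hf := by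
    rintro ⟨r, hr⟩
    exact ⟨_, hr.cons (Or.inr (Or.inr ⟨rfl, hf⟩)) (by simp), yields_cons r (by simp)⟩
  trapped s t he hbad hall := by
    -- If the program is enabled, its own step leads to a violation and respects its priority. If it
    -- is disabled, the environment may execute even right after another environment step.
    by_cases hen : Enabled δp s
    · obtain ⟨u, hu⟩ := hen
      rcases hall u with h | h | ⟨r, hr⟩
      · obtain ⟨r, hr⟩ := exists_violates_of_bad (δe := δe) (f := f) (Or.inl ⟨rfl, hu⟩) h
        exact ⟨_, hr, yields_cons r (by simp)⟩
      · exact absurd (hres.subset ⟨hu, h⟩) (Set.notMem_empty _)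
      · exact ⟨_, hr.cons (Or.inl ⟨rfl, hu⟩) (by simp), yields_cons r (by simp)⟩
    · rcases hbad with ⟨r, hr, hy⟩ | h
      · exact ⟨_, hr.cons (Or.inr (Or.inl ⟨rfl, he⟩)) fun _ => hy, yields_cons r fun _ => hen⟩
      · obtain ⟨r, hr⟩ := exists_violates_of_bad (δp := δp) (f := f) (Or.inr (Or.inl ⟨rfl, he⟩)) h
        exact ⟨_, hr, yields_cons r fun _ => hen⟩
  environment_bad s t he hb := by
    obtain ⟨r, hr⟩ := exists_violates_of_bad (δp := δp) (f := f) (Or.inr (Or.inl ⟨rfl, he⟩)) hb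
    exact ⟨_, hr⟩
  environment s t he := by
    rintro ⟨r, hr, hy⟩
    exact ⟨_, hr.cons (Or.inr (Or.inl ⟨rfl, he⟩)) fun _ => hy⟩
  le := fun _ ⟨r, hr, _⟩ => ⟨r, hr⟩

/-- Completeness: the invariant of every solution is admissible. -/
theorem IsFailsafeAddition.isAdmissible {L T : Set σ} {δp' : Trans σ}
    (hsol : IsFailsafeAddition 2 δp δe f δr ⟨δb, L, T⟩ S δp' X)
    (hS : ∀ s ∈ S, Enabled (δp ∪ δe) s)
    (hleast : ∀ N₁ N₂, IsUnsafePair δe δb δr f N₁ N₂ → M₂ ⊆ N₂) :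
    IsLive (safeProgram δp S (avoided δb δr M₂)) δe X ∧
      IsAdmissible (safeProgram δp S (avoided δb δr M₂)) δp δe (S \ M₂) X := by
  have hclosed := hsol.c2.1.1
  have hXS : X ⊆ S := by
    intro s hs
    obtain ⟨r, rfl, hr, -⟩ := exists_computation δp' δe ∅ s
    exact (hsol.c1 r hr.isComputation hs).2
  have hXM : ∀ s ∈ X, s ∉ M₂ := by
    intro s hs hsM
    -- By minimality of `M₂`, some computation of the solution with faults starts in `s` and
    -- violates safety; its prefix of length `j + 1` contradicts C2.
    obtain ⟨r, hr, rfl, j, hj, hb⟩ := hleast _ _ (isUnsafePair_violates hsol.c3) hsM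
    have hj' : ((j + 1 : ℕ) : ℕ∞) ≤ r.steps := by
      rw [Nat.cast_add, Nat.cast_one]
      exact Order.add_one_le_of_lt hj
    exact hsol.c2.2 r hr hs (j + 1) hj' j
      (show (j : ℕ∞) < ((j + 1 : ℕ) : ℕ∞) by exact_mod_cast Nat.lt_succ_self j) hb
  have hprog : ∀ s ∈ X, ∀ t, (s, t) ∈ δp' →
      t ∈ X ∧ (s, t) ∈ safeProgram δp S (avoided δb δr M₂) := by
    intro s hs t hst
    have ht : t ∈ X := hclosed s t (Or.inl hst) hs
    obtain ⟨r, hr, h0, rfl, rfl, ha⟩ :=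
      exists_computation_step (δe := δe) (a := Actor.program) (Or.inl ⟨rfl, hst⟩)
    have hp : r.edge 0 ∈ δp := by
      rcases (hsol.c1 r hr hs).1.step 0 h0 with h | h
      · exact h.2
      · exact absurd (ha.symm.trans h.1) (by simp)
    refine ⟨ht, ⟨hp, hXS hs, hXS ht⟩, ?_⟩
    rintro (h | h | h)
    · exact hsol.c2.1.notMem_bad hs hst h
    · exact Set.notMem_empty _ (hsol.c3.subset ⟨hst, h⟩)
    · exact hXM _ ht h
  have hlive : IsLive (safeProgram δp S (avoided δb δr M₂)) δe X := by
    refine ⟨fun s t hst hs => hclosed s t (Or.inr hst) hs, fun s hs => ?_⟩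
    by_cases hen : Enabled (δp' ∪ δe) s
    · obtain ⟨t, h⟩ := hen
      refine ⟨t, hclosed s t h hs, h.imp_left fun h => (hprog s hs t h).2⟩
    -- At a deadlock of the new program, the run without steps is a computation; by C1 the old
    -- program deadlocks there too, contrary to `hS`.
    · obtain ⟨r, rfl, hr, -⟩ := exists_computation δp' δe ∅ s
      have hsteps : r.steps = ((0 : ℕ) : ℕ∞) := by
        by_contra h
        have h0 : ((0 : ℕ) : ℕ∞) < r.steps := lt_of_le_of_ne (by simp) (Ne.symm h)
        exact hen ⟨_, (hr.isComputation.step 0 h0).imp And.right And.right⟩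
      exact absurd (hS _ (hXS hs)) ((hsol.c1 r hr.isComputation hs).1.maximal 0 hsteps)
  refine ⟨hlive, fun s hs => ⟨hXS hs, hXM s hs⟩, hlive.mono fun p hp => hp.1.1,
    fun s hs t hst ⟨u, htu⟩ hpt => ?_⟩
  have ht : t ∈ X := hclosed s t (Or.inr hst) hs
  by_cases hen : Enabled δp' t
  · obtain ⟨v, htv⟩ := hen
    exact ⟨v, hprog t ht v htv⟩
  -- If the new program were disabled at `t`, the environment could execute twice in a row; by C1
  -- this would be a computation of the old program, which has priority at `t`.
  · obtain ⟨r, hr, h1, rfl, rfl, ha, ha'⟩ := exists_computation_environment hst htu hen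
    have h0 : ((0 : ℕ) : ℕ∞) < r.steps := lt_trans (by simp) h1
    have := (hsol.c1 r hr hs).1.fair 0 h0 ha 1 (by omega) (by omega) h1 hpt
    exact absurd (ha'.symm.trans this) (by simp)

end Correctness

end FailsafeTolerance

/-! ### The time bound, soundness and completeness combined -/

theorem theorem2 :
    ∃ P : Polynomial ℕ, ∀ (σ : Type) [FinEnum σ] (I : FailsafeTolerance.Input σ),
      ∃ (result : Option ((σ × σ → Bool) × (σ → Bool))) (time : ℕ),
        -- the algorithm terminates with `result` after `time` steps, polynomially many
        (FailsafeTolerance.addFailsafe I).run 0 = some (result, time) ∧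
        time ≤ P.eval (FinEnum.card σ) ∧
        ∀ L T : Set σ,
          let δp := FailsafeTolerance.toSet I.δp
          let δe := FailsafeTolerance.toSet I.δe
          let S := FailsafeTolerance.toSet I.S
          let δr := FailsafeTolerance.toSet I.δr
          let f := FailsafeTolerance.toSet I.f
          let spec : FailsafeTolerance.Spec σ := ⟨FailsafeTolerance.toSet I.δb, L, T⟩
          FailsafeTolerance.Refines 2 δp δe spec S →
          δp ∩ δr = ∅ →
          (∀ s₀ ∈ S, ∃ s₁ ∈ S, (s₀, s₁) ∈ δp ∪ δe) →
          -- soundness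
          (∀ (δp' : σ × σ → Bool) (S' : σ → Bool), result = some (δp', S') →
            FailsafeTolerance.toSet S' ⊆ S ∧
            FailsafeTolerance.IsFailsafeAddition 2 δp δe f δr spec S
              (FailsafeTolerance.toSet δp') (FailsafeTolerance.toSet S')) ∧
          -- completeness
          (result = none →
            ¬ ∃ (δp'' : FailsafeTolerance.Trans σ) (S'' : Set σ),
              FailsafeTolerance.IsFailsafeAddition 2 δp δe f δr spec S δp'' S'') := by
  refine ⟨Polynomial.C 10000 * (Polynomial.X + 1) ^ 4, fun σ _ I => ?_⟩
  obtain ⟨result, time, htime, hrun, M₁, M₂, hM, hleast, hout⟩ :=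
    FailsafeTolerance.returns_addFailsafe I 0
  refine ⟨result, time, by rw [zero_add] at hrun; exact hrun, by simpa using htime,
    fun L T href hres hS => ⟨fun δp' S' h => ?_, ?_⟩⟩
  · subst h
    obtain ⟨hne, hX, hδ⟩ := hout
    refine ⟨fun s hs => (hX.subset hs).1, ?_⟩
    rw [hδ]
    exact hX.isFailsafeAddition href hres hM hne
  · rintro rfl ⟨δp'', S'', hsol⟩
    obtain ⟨hlive, hadm⟩ := hsol.isAdmissible (fun s hs => (hS s hs).imp fun t ht => ht.2) hleast
    exact hsol.nonempty.ne_empty (hout S'' hlive hadm)
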